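/- Let $\mathbf n=(n_1,n_2,n_3)\in\mathbb R[u,v]^3$ be a polynomial vector field of degree $k=\max_i\deg n_i$ with $\gcd(n_1,n_2,n_3)=1$, and let $\mathbf N=(N_1,N_2,N_3)$, $N_i=w^k n_i(u/w,v/w)\in R=\mathbb C[u,v,w]$, be its homogenization. Put $\mathrm{Syz}(\mathbf N)=\{\mathbf Q\in R^3 : \sum_i Q_iN_i=0\}$ and let $\mathrm{HF}(\mathrm{Syz}(\mathbf N),\ell)$ be the complex dimension of the space of those $\mathbf Q\in\mathrm{Syz}(\mathbf N)$ whose components are all homogeneous of degree $\ell$. Binomial coefficients $\binom m2$ are understood to be $0$ for $m<2$. A base point of $\mathbf N$ is a common zero of $N_1,N_2,N_3$ in $\mathbb P^2_{\mathbb C}$. A base point of $\mathbf n$ is either a common zero of $n_1,n_2,n_3$ in $\mathbb C^2$, or (a base point at infinity) a common zero in $\mathbb P^1_{\mathbb C}$ of the parts of $n_1,n_2,n_3$ of degree $k$. Then: 1. For every integer $\ell\ge 0$, $$\mathrm{HF}(\mathrm{Syz}(\mathbf N),\ell)\ \ge\ 3\binom{\ell-k+2}{2}-\binom{\ell-2k+2}{2}.$$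 Equality holds for all $\ell\ge 0$ if and only if $\mathbf N$ has no base points. Moreover, for each single $\ell\ge\max(0,2k-2)$, equality holds for this $\ell$ if and only if $\mathbf N$ has no base points. 2. $\mathbf N$ has no base points if and only if $\mathbf n$ has none. For every $\ell\ge 0$, $\mathrm{HF}(\mathrm{Syz}(\mathbf N),\ell)$ is the real dimension of the space of fields $\mathbf q\in\mathbb R[u,v]^3$ of degree at most $\ell$ with $\mathbf q\cdot\mathbf n\equiv 0$. 3. Regard $\mathbf q\cdot\mathbf n\equiv 0$, for $\mathbf q$ of degree at most $\ell$, as a system of $\binom{k+\ell+2}{2}$ homogeneous linear equations in the $3\binom{\ell+2}{2}$ coefficients of $\mathbf q$, and say that it has full rank if its rank equals the number of equations. If it has full rank for some $\ell\ge 0$, then $\mathbf n$ has no base points; for every $\ell\ge\max(0,2k-2)$, it has full rank if and only if $\mathbf n$ has no base points. 4. If $\mathbf n$ has no base points and $\ell\ge\max(0,2k-2)$, then the space of fields of degree at most $\ell$ orthogonal to $\mathbf n$ has real dimension $$3\binom{\ell+2}{2}-\binom{k+\ell+2}{2}.$$ -/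

import Mathlib

open MvPolynomial

/-- The syzygy module of a triple `f` over a commutative ring `R`:
all `q ∈ R³` with `q₁ f₁ + q₂ f₂ + q₃ f₃ = 0`. -/
def syz {R : Type*} [CommRing R] (f : Fin 3 → R) : Submodule R (Fin 3 → R) where
  carrier := {q | ∑ i, q i * f i = 0}
  zero_mem' := by simp
  add_mem' := by
    intro a b ha hb
    simp only [Set.mem_ofPred_eq, Pi.add_apply, add_mul, Finset.sum_add_distrib] at *
    rw [ha, hb, add_zero]
  smul_mem' := by
    intro c a ha
    simp only [Set.mem_ofPred_eq, Pi.smul_apply, smul_eq_mul, mul_assoc, ← Finset.mul_sum] at *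
    rw [ha, mul_zero]

/-- The degree of a polynomial vector field in the variables `u = X 0`, `v = X 1`:
the maximum of the total degrees of its components. -/
noncomputable def fieldDegree (n : Fin 3 → MvPolynomial (Fin 2) ℝ) : ℕ :=
  Finset.univ.sup fun i => (n i).totalDegree

/-- The greatest common divisor of the three components is `1`. -/
def CoprimeComponents (n : Fin 3 → MvPolynomial (Fin 2) ℝ) : Prop :=
  ∀ d : MvPolynomial (Fin 2) ℝ, (∀ i, d ∣ n i) → IsUnit d

/-- The homogenization `w ^ k * p (u / w, v / w)` of a polynomial `p` with `deg p ≤ k`, as an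
element of `ℂ[u, v, w]` with `u = X 0`, `v = X 1`, `w = X 2`. -/
noncomputable def homogenizeTo (k : ℕ) (p : MvPolynomial (Fin 2) ℝ) : MvPolynomial (Fin 3) ℂ :=
  ∑ m ∈ p.support, C ((p.coeff m : ℝ) : ℂ) * (X 0 ^ m 0 * X 1 ^ m 1 * X 2 ^ (k - (m 0 + m 1)))

/-- The homogenization of a vector field: all components are homogenized to the same degree,
the degree of the field. -/
noncomputable def homogenizeField (n : Fin 3 → MvPolynomial (Fin 2) ℝ) :
    Fin 3 → MvPolynomial (Fin 3) ℂ :=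
  fun i => homogenizeTo (fieldDegree n) (n i)

/-- The degree `l` piece of the graded module `Syz(N) ⊆ ℂ[u, v, w]³`: the syzygies all of whose
components are homogeneous of degree `l`. -/
noncomputable def syzPiece (N : Fin 3 → MvPolynomial (Fin 3) ℂ) (l : ℕ) :
    Submodule ℂ (Fin 3 → MvPolynomial (Fin 3) ℂ) :=
  (syz N).restrictScalars ℂ ⊓ Submodule.pi Set.univ fun _ => homogeneousSubmodule (Fin 3) ℂ l

/-- The Hilbert function of `Syz(N)`. -/
noncomputable def hilbertSyz (N : Fin 3 → MvPolynomial (Fin 3) ℂ) (l : ℕ) : ℕ :=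
  Module.finrank ℂ (syzPiece N l)

/-- A homogeneous field has no base point in the complex projective plane (the point is given by
its homogeneous coordinates). -/
def HomBasepointFree (N : Fin 3 → MvPolynomial (Fin 3) ℂ) : Prop :=
  ¬ ∃ x : Fin 3 → ℂ, x ≠ 0 ∧ ∀ i, eval x (N i) = 0

/-- An affine field of degree `k` has no base point over `ℂ`, neither a finite one (a common zero
of the components in `ℂ²`) nor one at infinity (a nontrivial common zero of the terms of
degree `k`). -/
def BasepointFree (n : Fin 3 → MvPolynomial (Fin 2) ℝ) : Prop :=
  (¬ ∃ x : Fin 2 → ℂ, ∀ i, aeval x (n i) = 0) ∧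
  ¬ ∃ x : Fin 2 → ℂ, x ≠ 0 ∧ ∀ i, aeval x (homogeneousComponent (fieldDegree n) (n i)) = 0

/-- The real vector space of fields of degree at most `l` that are orthogonal to `n`. -/
noncomputable def orthogonalFields (n : Fin 3 → MvPolynomial (Fin 2) ℝ) (l : ℕ) :
    Submodule ℝ (Fin 3 → MvPolynomial (Fin 2) ℝ) :=
  (syz n).restrictScalars ℝ ⊓ Submodule.pi Set.univ fun _ => restrictTotalDegree (Fin 2) ℝ l

/-- The exponents of the monomials in `u, v` of degree at most `d`. -/
def exponents (d : ℕ) : Finset (Fin 2 →₀ ℕ) :=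
  (Finset.range (d + 1)).biUnion fun e => Finset.univ.finsuppAntidiag e

theorem mem_exponents (d : ℕ) (m : Fin 2 →₀ ℕ) : m ∈ exponents d ↔ m 0 + m 1 ≤ d := by
  simp [exponents, Finset.mem_finsuppAntidiag, Fin.sum_univ_two]

/-- The matrix of the linear system `q · n ≡ 0` in the unknown coefficients of a field `q` of
degree at most `l`. There is one equation for each monomial of degree at most `deg n + l`, and one
unknown for each component of `q` and each monomial of degree at most `l`. -/
noncomputable def orthogonalityMatrix (n : Fin 3 → MvPolynomial (Fin 2) ℝ) (l : ℕ) :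
    Matrix (exponents (fieldDegree n + l)) (Fin 3 × exponents l) ℝ :=
  Matrix.of fun e c => coeff e.1 (monomial c.2.1 1 * n c.1)

/-- The system `q · n ≡ 0` for fields of degree at most `l` has full rank: its rank is the number
of its equations. -/
def FullRank (n : Fin 3 → MvPolynomial (Fin 2) ℝ) (l : ℕ) : Prop :=
  (orthogonalityMatrix n l).rank = Fintype.card (exponents (fieldDegree n + l))

/-! Setting w = 1 identifies Syz(N) in degree l with the affine syzygies of degree at most l
(`map_dehomogenize_syzPiece`). These are the kernel of a real matrix, so their dimension is the same
over ℝ and ℂ (`finrank_ker_map_ofReal`). The Koszul argument therefore runs over ℝ, where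
coprimality is assumed, and ℂ enters through base points only.

The lower bound counts the Koszul syzygies n × a with deg a ≤ l - k. Since gcd(n) = 1, n × a = 0
only for a = c n (`exists_smul_eq_of_cross_eq_zero`), which gives exactly the stated number
(`finrank_koszul_eq`). For l ≥ 2k - 2, a vanishing third difference turns that number into 3
C(l+2,2) - C(k+l+2,2), so equality means full rank: every polynomial of degree at most k + l is a
combination of the n_i with coefficients of degree at most l. Testing this on 1 and on powers of u
and v excludes base points (`SpansDegree.basepointFree`).

Conversely, without base points the Nullstellensatz yields full rank for all large l
(`exists_spansDegree`), so there every syzygy is Koszul by dimension. This passes from l + 1 down to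
l (`boundedSyz_le_range_koszulMap_of_succ`), hence holds for every l. -/

/-- The polynomials in `u, v` of degree less than `m`. -/
noncomputable def degreeLT (K : Type*) [Field K] (m : ℕ) : Submodule K (MvPolynomial (Fin 2) K) :=
  restrictSupport K {e | e.degree < m}

/-! ### Polynomials of bounded degree and their dimension. -/

section DegreeLT

variable {K : Type*} [Field K]

theorem mem_degreeLT {m : ℕ} {p : MvPolynomial (Fin 2) K} :
    p ∈ degreeLT K m ↔ ∀ e, coeff e p ≠ 0 → e.degree < m := by
  simp [degreeLT, mem_restrictSupport_iff, Set.subset_def]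

theorem mem_degreeLT_iff {m : ℕ} {p : MvPolynomial (Fin 2) K} :
    p ∈ degreeLT K m ↔ p = 0 ∨ p.totalDegree < m := by
  rw [mem_degreeLT]
  constructor
  · intro h
    by_cases hp : p = 0
    · exact Or.inl hp
    · right
      obtain ⟨e, he⟩ := MvPolynomial.ne_zero_iff.mp hp
      have hm : 0 < m := (Nat.zero_le _).trans_lt (h e he)
      rw [totalDegree, Finset.sup_lt_iff (by simpa using hm)]
      intro b hb
      exact h b (mem_support_iff.mp hb)
  · rintro (rfl | h) e he
    · simp at he
    · exact lt_of_le_of_lt (le_totalDegree (mem_support_iff.mpr he)) h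

theorem restrictTotalDegree_eq_degreeLT (l : ℕ) :
    restrictTotalDegree (Fin 2) K l = degreeLT K (l + 1) := by
  ext p
  rw [mem_restrictTotalDegree, mem_degreeLT_iff]
  constructor
  · intro h
    right
    omega
  · rintro (rfl | h)
    · simp
    · omega

theorem degreeLT_mono {a b : ℕ} (h : a ≤ b) : degreeLT K a ≤ degreeLT K b :=
  restrictSupport_mono K fun _ he => lt_of_lt_of_le he h

theorem mul_mem_degreeLT {a b : ℕ} {p q : MvPolynomial (Fin 2) K} (hp : p ∈ degreeLT K a)
    (hq : q.totalDegree ≤ b) : p * q ∈ degreeLT K (a + b) := by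
  rw [mem_degreeLT_iff] at *
  rcases hp with rfl | hp
  · simp
  · right
    have := totalDegree_mul p q
    omega

/-- Degrees add over a domain. The strict bound makes truncated subtraction harmless: if a ≤ b, then
p = 0, and `degreeLT K 0` is zero. -/
theorem mem_degreeLT_of_mul {a b : ℕ} {p q : MvPolynomial (Fin 2) K}
    (h : p * q ∈ degreeLT K a) (hq : q ≠ 0) (hb : b ≤ q.totalDegree) :
    p ∈ degreeLT K (a - b) := by
  rw [mem_degreeLT_iff] at *
  by_cases hp : p = 0
  · exact Or.inl hp
  · right
    rcases h with h | h
    · simp [hp, hq] at h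
    · rw [totalDegree_mul_of_isDomain hp hq] at h
      omega

theorem card_exponents (d : ℕ) : (exponents d).card = Nat.choose (d + 2) 2 := by
  have h : ∀ e : ℕ, (Finset.finsuppAntidiag (Finset.univ : Finset (Fin 2)) e).card = e + 1 := by
    intro e
    rw [← Finset.Nat.card_antidiagonal e]
    refine Finset.card_bij (fun f _ => (f 0, f 1)) ?_ ?_ ?_
    · intro f hf
      simpa [Finset.mem_finsuppAntidiag, Fin.sum_univ_two] using hf
    · intro f _ g _ hfg
      simp only [Prod.mk.injEq] at hfg
      ext i
      fin_cases i
      · exact hfg.1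
      · exact hfg.2
    · rintro ⟨a, b⟩ hab
      refine ⟨Finsupp.equivFunOnFinite.symm ![a, b], ?_, ?_⟩
      · simpa [Finset.mem_finsuppAntidiag, Fin.sum_univ_two] using hab
      · simp
  rw [exponents, Finset.card_biUnion]
  · simp only [h]
    induction d with
    | zero => simp
    | succ d ih =>
      rw [Finset.sum_range_succ, ih, Nat.choose_succ_succ' (d + 2) 1, Nat.choose_one_right]
      ring
  · intro a _ b _ hab
    rw [Function.onFun, Finset.disjoint_left]
    intro f hf hg
    simp only [Finset.mem_finsuppAntidiag] at hf hg
    exact hab (hf.1.symm.trans hg.1)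

theorem coe_exponents (d : ℕ) : {e : Fin 2 →₀ ℕ | e.degree < d + 1} = exponents d := by
  ext e
  simp [mem_exponents, Finsupp.degree_eq_sum]

instance (m : ℕ) : FiniteDimensional K (degreeLT K m) := by
  have : degreeLT K m ≤ degreeLT K (m + 1) := degreeLT_mono (Nat.le_succ m)
  have h : FiniteDimensional K (degreeLT K (m + 1)) := by
    rw [degreeLT, coe_exponents]
    exact Module.Finite.of_basis (basisRestrictSupport K (exponents m : Set (Fin 2 →₀ ℕ)))
  exact Submodule.finiteDimensional_of_le this

theorem finrank_degreeLT (m : ℕ) : Module.finrank K (degreeLT K m) = Nat.choose (m + 1) 2 := by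
  cases m with
  | zero =>
    have : degreeLT K 0 = ⊥ := by
      ext p
      simp [mem_degreeLT_iff]
    rw [this]
    simp
  | succ d =>
    rw [degreeLT, coe_exponents, Module.finrank_eq_nat_card_basis (basisRestrictSupport K _),
      ← card_exponents]
    simp

end DegreeLT

/-! ### The linear system in the coefficients. -/

section Matrix

variable {K : Type*} [Field K]

/-- The syzygies of degree at most `l` of a triple of polynomials in `u, v`. -/
noncomputable def boundedSyz (n : Fin 3 → MvPolynomial (Fin 2) K) (l : ℕ) :
    Submodule K (Fin 3 → MvPolynomial (Fin 2) K) :=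
  (syz n).restrictScalars K ⊓ Submodule.pi Set.univ fun _ => restrictTotalDegree (Fin 2) K l

theorem mem_boundedSyz {n : Fin 3 → MvPolynomial (Fin 2) K} {l : ℕ}
    {q : Fin 3 → MvPolynomial (Fin 2) K} :
    q ∈ boundedSyz n l ↔ ∑ i, q i * n i = 0 ∧ ∀ i, q i ∈ degreeLT K (l + 1) := by
  simp only [boundedSyz, restrictTotalDegree_eq_degreeLT]
  simp [syz, Submodule.mem_pi]

/-- The matrix of the map `q ↦ ∑ i, q i * n i` on the triples of degree at most `l`, with values in
the polynomials of degree at most `d`. -/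
noncomputable def sylvesterMatrix (n : Fin 3 → MvPolynomial (Fin 2) K) (d l : ℕ) :
    Matrix (exponents d) (Fin 3 × exponents l) K :=
  Matrix.of fun e c => coeff e.1 (monomial c.2.1 1 * n c.1)

/-- The triple of polynomials with given coefficients. -/
noncomputable def ofCoeffs (K : Type*) [Field K] (l : ℕ) :
    (Fin 3 × exponents l → K) →ₗ[K] (Fin 3 → MvPolynomial (Fin 2) K) where
  toFun c i := ∑ e : exponents l, monomial e.1 (c (i, e))
  map_add' a b := by
    ext1 i
    simp [Finset.sum_add_distrib]
  map_smul' r a := by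
    ext1 i
    simp [Finset.smul_sum, smul_monomial]

theorem coeff_ofCoeffs {l : ℕ} (c : Fin 3 × exponents l → K) (i : Fin 3) (e : exponents l) :
    coeff e.1 (ofCoeffs K l c i) = c (i, e) := by
  simp [ofCoeffs, coeff_sum, coeff_monomial]

theorem ofCoeffs_injective (l : ℕ) : Function.Injective (ofCoeffs K l) := by
  intro a b h
  ext ⟨i, e⟩
  rw [← coeff_ofCoeffs a, h, coeff_ofCoeffs]

theorem ofCoeffs_mem {l : ℕ} (c : Fin 3 × exponents l → K) (i : Fin 3) :
    ofCoeffs K l c i ∈ degreeLT K (l + 1) := by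
  refine Submodule.sum_mem _ fun e _ => ?_
  rw [degreeLT, coe_exponents, monomial_mem_restrictSupport]
  exact Or.inl e.2

theorem exists_ofCoeffs_eq {l : ℕ} {q : Fin 3 → MvPolynomial (Fin 2) K}
    (hq : ∀ i, q i ∈ degreeLT K (l + 1)) : ∃ c, ofCoeffs K l c = q := by
  refine ⟨fun x => coeff x.2.1 (q x.1), ?_⟩
  ext1 i
  have hs : (q i).support ⊆ exponents l := by
    have := hq i
    rw [degreeLT, coe_exponents, mem_restrictSupport_iff] at this
    exact_mod_cast this
  conv_rhs => rw [← support_sum_monomial_coeff (q i)]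
  rw [Finset.sum_subset hs]
  · exact Finset.sum_coe_sort (exponents l) fun e => monomial e (coeff e (q i))
  · intro e _ he
    simp [notMem_support_iff.mp he]

theorem sylvesterMatrix_mulVec (n : Fin 3 → MvPolynomial (Fin 2) K) (d l : ℕ)
    (c : Fin 3 × exponents l → K) (e : exponents d) :
    (sylvesterMatrix n d l).mulVec c e = coeff e.1 (∑ i, ofCoeffs K l c i * n i) := by
  have h : ∀ (a : Fin 2 →₀ ℕ) (r : K), monomial a r = C r * monomial a 1 := by
    intro a r
    simp [C_mul_monomial]
  simp only [Matrix.mulVec, dotProduct, sylvesterMatrix, Matrix.of_apply, Fintype.sum_prod_type,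
    ofCoeffs, LinearMap.coe_mk, AddHom.coe_mk, coeff_sum, Finset.sum_mul]
  refine Finset.sum_congr rfl fun i _ => Finset.sum_congr rfl fun a _ => ?_
  rw [h a.1 (c (i, a)), mul_assoc, coeff_C_mul, mul_comm]

theorem sum_mul_mem_degreeLT {n q : Fin 3 → MvPolynomial (Fin 2) K} {k m : ℕ}
    (hn : ∀ i, (n i).totalDegree ≤ k) (hq : ∀ i, q i ∈ degreeLT K m) :
    ∑ i, q i * n i ∈ degreeLT K (m + k) :=
  Submodule.sum_mem _ fun i _ => mul_mem_degreeLT (hq i) (hn i)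

theorem eq_of_coeff_eq {d : ℕ} {p q : MvPolynomial (Fin 2) K} (hp : p ∈ degreeLT K (d + 1))
    (hq : q ∈ degreeLT K (d + 1)) (h : ∀ e : exponents d, coeff e.1 p = coeff e.1 q) : p = q := by
  rw [← sub_eq_zero]
  by_contra hne
  obtain ⟨e, he⟩ := MvPolynomial.ne_zero_iff.mp hne
  have := mem_degreeLT.mp (sub_mem hp hq) e he
  have hm : e ∈ (exponents d : Set (Fin 2 →₀ ℕ)) := by
    rw [← coe_exponents]
    exact this
  exact he (by rw [coeff_sub, h ⟨e, hm⟩, sub_self])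

theorem map_ofCoeffs_ker {n : Fin 3 → MvPolynomial (Fin 2) K} {k : ℕ} (l : ℕ)
    (hn : ∀ i, (n i).totalDegree ≤ k) :
    Submodule.map (ofCoeffs K l) (LinearMap.ker (sylvesterMatrix n (k + l) l).mulVecLin)
      = boundedSyz n l := by
  ext q
  rw [Submodule.mem_map, mem_boundedSyz]
  constructor
  · rintro ⟨c, hc, rfl⟩
    refine ⟨?_, ofCoeffs_mem c⟩
    refine eq_of_coeff_eq (d := k + l) ?_ (zero_mem _) fun e => ?_
    · have := sum_mul_mem_degreeLT hn (ofCoeffs_mem c)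
      rwa [show l + 1 + k = k + l + 1 by ring] at this
    · rw [← sylvesterMatrix_mulVec]
      exact congrFun hc e
  · rintro ⟨h, hq⟩
    obtain ⟨c, rfl⟩ := exists_ofCoeffs_eq hq
    refine ⟨c, ?_, rfl⟩
    rw [LinearMap.mem_ker]
    ext e
    rw [Matrix.mulVecLin_apply, sylvesterMatrix_mulVec, h]
    simp

theorem finrank_boundedSyz {n : Fin 3 → MvPolynomial (Fin 2) K} {k : ℕ} (l : ℕ)
    (hn : ∀ i, (n i).totalDegree ≤ k) :
    Module.finrank K (boundedSyz n l)
      = Module.finrank K (LinearMap.ker (sylvesterMatrix n (k + l) l).mulVecLin) := by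
  rw [← map_ofCoeffs_ker l hn]
  exact (Submodule.equivMapOfInjective _ (ofCoeffs_injective l) _).finrank_eq.symm

theorem finrank_boundedSyz_add_rank {n : Fin 3 → MvPolynomial (Fin 2) K} {k : ℕ} (l : ℕ)
    (hn : ∀ i, (n i).totalDegree ≤ k) :
    Module.finrank K (boundedSyz n l) + (sylvesterMatrix n (k + l) l).rank
      = 3 * Nat.choose (l + 2) 2 := by
  rw [finrank_boundedSyz l hn, Matrix.rank, add_comm, LinearMap.finrank_range_add_finrank_ker]
  simp [card_exponents]

/-- Full row rank is surjectivity on coefficient vectors; this form can be tested on single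
polynomials. -/
theorem rank_sylvesterMatrix_eq_card_iff {n : Fin 3 → MvPolynomial (Fin 2) K} {k : ℕ} (l : ℕ)
    (hn : ∀ i, (n i).totalDegree ≤ k) :
    (sylvesterMatrix n (k + l) l).rank = Fintype.card (exponents (k + l)) ↔
      ∀ p ∈ degreeLT K (k + l + 1), ∃ q : Fin 3 → MvPolynomial (Fin 2) K,
        (∀ i, q i ∈ degreeLT K (l + 1)) ∧ ∑ i, q i * n i = p := by
  have hr : (sylvesterMatrix n (k + l) l).rank = Fintype.card (exponents (k + l)) ↔
      Function.Surjective (sylvesterMatrix n (k + l) l).mulVecLin := by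
    rw [← LinearMap.range_eq_top, Matrix.rank]
    constructor
    · intro h
      apply Submodule.eq_top_of_finrank_eq
      rw [h]
      simp
    · intro h
      rw [h]
      simp
  rw [hr]
  constructor
  · intro h p hp
    obtain ⟨c, hc⟩ := h fun e => coeff e.1 p
    refine ⟨ofCoeffs K l c, ofCoeffs_mem c, eq_of_coeff_eq (d := k + l) ?_ hp fun e => ?_⟩
    · have := sum_mul_mem_degreeLT hn (ofCoeffs_mem c)
      rwa [show l + 1 + k = k + l + 1 by ring] at this
    · rw [← sylvesterMatrix_mulVec]
      exact congrFun hc e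
  · intro h v
    have hp : ∑ e : exponents (k + l), monomial e.1 (v e) ∈ degreeLT K (k + l + 1) := by
      refine Submodule.sum_mem _ fun e _ => ?_
      rw [degreeLT, coe_exponents, monomial_mem_restrictSupport]
      exact Or.inl e.2
    obtain ⟨q, hq, hqp⟩ := h _ hp
    obtain ⟨c, rfl⟩ := exists_ofCoeffs_eq hq
    refine ⟨c, ?_⟩
    ext e
    rw [Matrix.mulVecLin_apply, sylvesterMatrix_mulVec, hqp]
    simp [coeff_sum, coeff_monomial]

end Matrix

/-! ### Graded pieces and proportional triples. -/

theorem homogeneousComponent_mul_of_isHomogeneous {σ R : Type*} [CommSemiring R]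
    {q : MvPolynomial σ R} {b : ℕ} (hq : q.IsHomogeneous b) (a : ℕ) (p : MvPolynomial σ R) :
    homogeneousComponent (a + b) (p * q) = homogeneousComponent a p * q := by
  classical
  let _ : GradedAlgebra (homogeneousSubmodule σ R) := gradedAlgebra
  have h := DirectSum.coe_decompose_mul_add_of_right_mem (homogeneousSubmodule σ R) (i := a)
    (a := p) (b := q) (j := b) hq
  rw [← decomposition.decompose'_apply, ← decomposition.decompose'_apply]
  exact h

theorem exists_smul_eq_of_cross_eq_zero {R : Type*} [CommRing R] [IsDomain R]
    [UniqueFactorizationMonoid R] {n a : Fin 3 → R} (hn : ∀ d, (∀ i, d ∣ n i) → IsUnit d)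
    (h : crossProduct n a = 0) : ∃ c : R, a = c • n := by
  classical
  have hc : ∀ i j, n i * a j = n j * a i := by
    rw [cross_apply] at h
    have h0 := congrFun h 0
    have h1 := congrFun h 1
    have h2 := congrFun h 2
    simp only [Matrix.cons_val, Pi.zero_apply, sub_eq_zero] at h0 h1 h2
    intro i j
    fin_cases i <;> fin_cases j <;> simp <;> first | assumption | (symm; assumption)
  obtain ⟨i, hi⟩ : ∃ i, n i ≠ 0 := by
    by_contra! h0
    exact not_isUnit_zero (hn 0 fun i => by rw [h0 i])
  let _ : StrongNormalizationMonoid R := UniqueFactorizationMonoid.strongNormalizationMonoid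
  let _ : NormalizedGCDMonoid R := UniqueFactorizationMonoid.toNormalizedGCDMonoid R
  have hu : IsUnit (Finset.univ.gcd n) := hn _ fun j => Finset.gcd_dvd (Finset.mem_univ j)
  -- By proportionality `n i` divides every `a i * n j`, hence their gcd, which is `a i` up to a
  -- unit.
  have hd : n i ∣ a i := by
    have h1 : n i ∣ Finset.univ.gcd fun j => a i * n j := by
      refine Finset.dvd_gcd fun j _ => ⟨a j, ?_⟩
      rw [hc i j, mul_comm]
    rw [(Finset.gcd_mul_left' Finset.univ n (a i)).dvd_iff_dvd_right] at h1
    exact hu.dvd_mul_right.mp h1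
  obtain ⟨c, hac⟩ := hd
  refine ⟨c, ?_⟩
  ext1 j
  apply mul_left_cancel₀ hi
  rw [hc i j, hac, Pi.smul_apply, smul_eq_mul]
  ring

/-! ### Koszul syzygies and descent in the degree. -/

section Koszul

variable {K : Type*} [Field K]

theorem mul_mem_degreeLT_of_sub {a b : ℕ} {p q : MvPolynomial (Fin 2) K}
    (hp : p ∈ degreeLT K (a - b)) (hq : q.totalDegree ≤ b) : p * q ∈ degreeLT K a := by
  rw [mem_degreeLT_iff] at *
  rcases hp with rfl | hp
  · simp
  · right
    have := totalDegree_mul p q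
    omega

/-- The Koszul map `a ↦ n × a` on the triples of degree less than `m`. -/
noncomputable def koszulMap (n : Fin 3 → MvPolynomial (Fin 2) K) (m : ℕ) :
    (Fin 3 → degreeLT K m) →ₗ[K] (Fin 3 → MvPolynomial (Fin 2) K) :=
  ((crossProduct n).restrictScalars K).comp
    (LinearMap.pi fun i => (degreeLT K m).subtype.comp (LinearMap.proj i))

theorem koszulMap_apply (n : Fin 3 → MvPolynomial (Fin 2) K) {m : ℕ} (a : Fin 3 → degreeLT K m) :
    koszulMap n m a = crossProduct n fun i => (a i : MvPolynomial (Fin 2) K) := rfl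

theorem mem_range_koszulMap {n q : Fin 3 → MvPolynomial (Fin 2) K} {m : ℕ} :
    q ∈ LinearMap.range (koszulMap n m) ↔
      ∃ a : Fin 3 → MvPolynomial (Fin 2) K, (∀ i, a i ∈ degreeLT K m) ∧ crossProduct n a = q := by
  constructor
  · rintro ⟨a, rfl⟩
    exact ⟨fun i => a i, fun i => (a i).2, rfl⟩
  · rintro ⟨a, ha, rfl⟩
    exact ⟨fun i => ⟨a i, ha i⟩, rfl⟩

/-- The map `c ↦ c n` from polynomials to triples of degree less than `m`. -/
noncomputable def smulField {n : Fin 3 → MvPolynomial (Fin 2) K} {k : ℕ}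
    (hk : ∀ i, (n i).totalDegree ≤ k) (m : ℕ) :
    degreeLT K (m - k) →ₗ[K] (Fin 3 → degreeLT K m) where
  toFun c i := ⟨c * n i, mul_mem_degreeLT_of_sub c.2 (hk i)⟩
  map_add' a b := by
    ext1 i
    ext1
    simp [add_mul]
  map_smul' r a := by
    ext1 i
    ext1
    simp

variable {n : Fin 3 → MvPolynomial (Fin 2) K} {k : ℕ}

theorem mem_degreeLT_of_smul {m : ℕ} {c : MvPolynomial (Fin 2) K}
    (htop : ∃ i, n i ≠ 0 ∧ (n i).totalDegree = k)
    (h : ∀ i, (c • n) i ∈ degreeLT K m) : c ∈ degreeLT K (m - k) := by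
  obtain ⟨i, hi, hd⟩ := htop
  exact mem_degreeLT_of_mul (h i) hi hd.ge

/-- Exactness of the Koszul complex at the triples a, with degree bounds: a component of n of full
degree k controls the degree of c in a = c n. -/
theorem range_smulField (hk : ∀ i, (n i).totalDegree ≤ k)
    (htop : ∃ i, n i ≠ 0 ∧ (n i).totalDegree = k) (hn : ∀ d, (∀ i, d ∣ n i) → IsUnit d) (m : ℕ) :
    LinearMap.range (smulField hk m) = LinearMap.ker (koszulMap n m) := by
  ext a
  rw [LinearMap.mem_ker, koszulMap_apply]
  constructor
  · rintro ⟨c, rfl⟩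
    have : (fun i => ((smulField hk m c i : degreeLT K m) : MvPolynomial (Fin 2) K))
        = (c : MvPolynomial (Fin 2) K) • n := rfl
    rw [this, map_smul, cross_self, smul_zero]
  · intro h
    obtain ⟨c, hc⟩ := exists_smul_eq_of_cross_eq_zero hn h
    refine ⟨⟨c, mem_degreeLT_of_smul htop fun i => ?_⟩, ?_⟩
    · rw [← hc]
      exact (a i).2
    · ext1 i
      ext1
      exact (congrFun hc i).symm

theorem finrank_range_koszulMap (hk : ∀ i, (n i).totalDegree ≤ k)
    (htop : ∃ i, n i ≠ 0 ∧ (n i).totalDegree = k) (hn : ∀ d, (∀ i, d ∣ n i) → IsUnit d) (m : ℕ) :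
    Module.finrank K (LinearMap.range (koszulMap n m)) + Nat.choose (m - k + 1) 2
      = 3 * Nat.choose (m + 1) 2 := by
  have hinj : Function.Injective (smulField hk m) := by
    obtain ⟨i, hi, -⟩ := htop
    intro c d h
    have := congrArg (Subtype.val) (congrFun h i)
    exact Subtype.ext (mul_right_cancel₀ hi this)
  have h := LinearMap.finrank_range_add_finrank_ker (koszulMap n m)
  rw [← range_smulField hk htop hn, LinearMap.finrank_range_of_inj hinj, finrank_degreeLT] at h
  rw [h]
  simp [Module.finrank_pi_fintype, finrank_degreeLT]

theorem range_koszulMap_le (hk : ∀ i, (n i).totalDegree ≤ k) (l : ℕ) :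
    LinearMap.range (koszulMap n (l + 1 - k)) ≤ boundedSyz n l := by
  intro q hq
  obtain ⟨a, ha, rfl⟩ := mem_range_koszulMap.mp hq
  rw [mem_boundedSyz]
  constructor
  · have := dot_self_cross n a
    simp only [dotProduct] at this
    simpa only [mul_comm] using this
  · have h : ∀ i j, n i * a j ∈ degreeLT K (l + 1) := fun i j => by
      rw [mul_comm]
      exact mul_mem_degreeLT_of_sub (ha j) (hk i)
    intro i
    rw [cross_apply]
    fin_cases i <;> exact sub_mem (h _ _) (h _ _)

theorem sub_homogeneousComponent_mem_degreeLT {s : ℕ} {p : MvPolynomial (Fin 2) K}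
    (hp : p ∈ degreeLT K (s + 1)) : p - homogeneousComponent s p ∈ degreeLT K s := by
  rw [mem_degreeLT]
  intro m hm
  rw [coeff_sub, coeff_homogeneousComponent] at hm
  have hpm : coeff m p ≠ 0 := by
    intro hz
    simp [hz] at hm
  have hlt := mem_degreeLT.mp hp m hpm
  have hne : m.degree ≠ s := by
    intro hs
    simp [hs] at hm
  omega

theorem homogeneousComponent_eq_zero_of_mem_degreeLT {s : ℕ} {p : MvPolynomial (Fin 2) K}
    (hp : p ∈ degreeLT K s) : homogeneousComponent s p = 0 := by
  rcases mem_degreeLT_iff.mp hp with h | h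
  · rw [h, map_zero]
  · exact homogeneousComponent_eq_zero _ _ h

theorem exists_eq_X_mul_add {s : ℕ} {c d : MvPolynomial (Fin 2) K} (hc : c ∈ degreeLT K s)
    (h : X 1 * c + X 0 * d ∈ degreeLT K s) :
    ∃ e r, c = X 0 * e + r ∧ r ∈ degreeLT K (s - 1) := by
  cases s with
  | zero => exact ⟨0, c, by simp, hc⟩
  | succ s =>
    have h0 := homogeneousComponent_eq_zero_of_mem_degreeLT h
    rw [map_add, mul_comm (X 1), mul_comm (X 0),
      homogeneousComponent_mul_of_isHomogeneous (isHomogeneous_X K 1),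
      homogeneousComponent_mul_of_isHomogeneous (isHomogeneous_X K 0)] at h0
    have hdvd : (X 0 : MvPolynomial (Fin 2) K) ∣ homogeneousComponent s c * X 1 :=
      ⟨-homogeneousComponent s d, by linear_combination h0⟩
    rcases (MvPolynomial.X_prime (R := K) (i := (0 : Fin 2))).dvd_or_dvd hdvd with hd | hd
    · obtain ⟨e, he⟩ := hd
      exact ⟨e, c - homogeneousComponent s c, by rw [← he]; ring,
        sub_homogeneousComponent_mem_degreeLT hc⟩
    · simp [X_dvd_X] at hd

/-- If all syzygies of degree at most `l + 1` are Koszul syzygies, then so are those of degree at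
most `l`. -/
theorem boundedSyz_le_range_koszulMap_of_succ (hk : ∀ i, (n i).totalDegree ≤ k)
    (htop : ∃ i, n i ≠ 0 ∧ (n i).totalDegree = k) (hn : ∀ d, (∀ i, d ∣ n i) → IsUnit d) {l : ℕ}
    (h : boundedSyz n (l + 1) ≤ LinearMap.range (koszulMap n (l + 1 + 1 - k))) :
    boundedSyz n l ≤ LinearMap.range (koszulMap n (l + 1 - k)) := by
  intro q hq
  rw [mem_boundedSyz] at hq
  obtain ⟨hq0, hqd⟩ := hq
  have hX : ∀ i : Fin 2, (X i : MvPolynomial (Fin 2) K).totalDegree = 1 := fun i => totalDegree_X i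
  have hXmem : ∀ (i : Fin 2) {t : ℕ} {p : MvPolynomial (Fin 2) K}, p ∈ degreeLT K t →
      X i * p ∈ degreeLT K (t + 1) := fun i t p hp => by
    rw [mul_comm]
    exact mul_mem_degreeLT hp (hX i).le
  have hlift : ∀ r : MvPolynomial (Fin 2) K, (∀ i, r * q i ∈ degreeLT K (l + 1 + 1)) →
      ∃ a : Fin 3 → MvPolynomial (Fin 2) K, (∀ i, a i ∈ degreeLT K (l + 1 + 1 - k)) ∧
        crossProduct n a = r • q := by
    intro r hr
    -- The hypothesis in degree l + 1 applies to q, u q and v q, but its multipliers D, A, B may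
    -- have degree one too large for q. The aim is to correct D by a multiple of n.
    refine mem_range_koszulMap.mp (h (mem_boundedSyz.mpr ⟨?_, hr⟩))
    simp only [Pi.smul_apply, smul_eq_mul, mul_assoc, ← Finset.mul_sum, hq0, mul_zero]
  obtain ⟨D, hD, hDq⟩ := hlift 1 fun i => by
    rw [one_mul]
    exact degreeLT_mono (Nat.le_succ _) (hqd i)
  obtain ⟨A, hA, hAq⟩ := hlift (X 0) fun i => hXmem 0 (hqd i)
  obtain ⟨B, hB, hBq⟩ := hlift (X 1) fun i => hXmem 1 (hqd i)
  rw [one_smul] at hDq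
  obtain ⟨c₃, hc₃⟩ := exists_smul_eq_of_cross_eq_zero hn
    (a := (X 0 : MvPolynomial (Fin 2) K) • D - A) (by
    rw [map_sub, map_smul, hDq, hAq, sub_self])
  obtain ⟨c₂, hc₂⟩ := exists_smul_eq_of_cross_eq_zero hn
    (a := B - (X 1 : MvPolynomial (Fin 2) K) • D) (by
    rw [map_sub, map_smul, hDq, hBq, sub_self])
  rcases Nat.lt_or_ge (l + 1) k with hlk | hlk
  · have hD0 : D = 0 := by
      ext1 i
      have := mem_degreeLT_iff.mp (hD i)
      rcases this with h | h
      · exact h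
      · omega
    rw [← hDq, hD0, map_zero]
    exact zero_mem _
  have hM : l + 1 + 1 - k = (l + 1 - k) + 1 := by omega
  rw [hM] at hD hA hB
  set m := l + 1 - k with hm
  have hc₃d : c₃ ∈ degreeLT K (m + 2 - k) := by
    refine mem_degreeLT_of_smul htop fun i => ?_
    rw [← hc₃]
    exact sub_mem (hXmem 0 (hD i)) (degreeLT_mono (Nat.le_succ _) (hA i))
  -- D cancels in this combination, so its degree is one less than expected. Hence u divides the top
  -- form of `c₃`.
  have hc₁d : X 1 * c₃ + X 0 * c₂ ∈ degreeLT K (m + 2 - k) := by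
    refine mem_degreeLT_of_smul htop fun i => ?_
    have : (X 1 * c₃ + X 0 * c₂) • n
        = (X 0 : MvPolynomial (Fin 2) K) • B - (X 1 : MvPolynomial (Fin 2) K) • A := by
      rw [add_smul, mul_smul, mul_smul, ← hc₃, ← hc₂, smul_sub, smul_sub, smul_comm (X 1)]
      abel
    rw [this]
    exact sub_mem (hXmem 0 (hB i)) (hXmem 1 (hA i))
  obtain ⟨e, r, her, hr⟩ := exists_eq_X_mul_add hc₃d hc₁d
  refine mem_range_koszulMap.mpr ⟨D - e • n, fun i => ?_, ?_⟩
  -- The right side has degree at most m, so dividing by u gains the missing degree; subtracting e n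
  -- leaves n × D unchanged.
  · have hmul : (D i - e * n i) * X 0 = A i + r * n i := by
      have := congrFun hc₃ i
      simp only [Pi.sub_apply, Pi.smul_apply, smul_eq_mul] at this
      linear_combination this + n i * her
    have hmem : (D i - e * n i) * X 0 ∈ degreeLT K (m + 1) := by
      rw [hmul]
      refine add_mem (hA i) (mul_mem_degreeLT_of_sub ?_ (hk i))
      rwa [show m + 1 - k = m + 2 - k - 1 by omega]
    exact mem_degreeLT_of_mul (a := m + 1) (b := 1) hmem (X_ne_zero _) (hX 0).ge
  · rw [map_sub, map_smul, cross_self, smul_zero, sub_zero, hDq]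

end Koszul

/-! ### Base points and spanning in large degree. -/

theorem sum_exponents_eq_of_isHomogeneous {σ R : Type*} [Fintype σ] [CommSemiring R] {d : ℕ}
    {p : MvPolynomial σ R} (hp : p.IsHomogeneous d) {e : σ →₀ ℕ} (he : e ∈ p.support) :
    ∑ i, e i = d := by
  rw [← Finsupp.degree_eq_sum]
  exact (hp.degree_eq_sum_deg_support he).symm

theorem totalDegree_le_fieldDegree (n : Fin 3 → MvPolynomial (Fin 2) ℝ) (i : Fin 3) :
    (n i).totalDegree ≤ fieldDegree n :=
  Finset.le_sup (f := fun i => (n i).totalDegree) (Finset.mem_univ i)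

section Nullstellensatz

variable {K : Type*} [Field K]

theorem mem_degreeLT_succ {p : MvPolynomial (Fin 2) K} {d : ℕ} :
    p ∈ degreeLT K (d + 1) ↔ p.totalDegree ≤ d := by
  rw [← restrictTotalDegree_eq_degreeLT, mem_restrictTotalDegree]

theorem homogeneousComponent_add_mul {p q : MvPolynomial (Fin 2) K} {a b : ℕ}
    (hp : p.totalDegree ≤ a) (hq : q.totalDegree ≤ b) :
    homogeneousComponent (a + b) (p * q) = homogeneousComponent a p * homogeneousComponent b q := by
  have h : (q - homogeneousComponent b q) * p ∈ degreeLT K (b + a) :=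
    mul_mem_degreeLT (sub_homogeneousComponent_mem_degreeLT (mem_degreeLT_succ.mpr hq)) hp
  have h0 := homogeneousComponent_eq_zero_of_mem_degreeLT h
  rw [← homogeneousComponent_mul_of_isHomogeneous (homogeneousComponent_isHomogeneous b q),
    ← sub_eq_zero, ← map_sub, ← mul_sub, mul_comm, add_comm a b]
  exact h0

/-- Every polynomial of degree at most `k + l` is a combination of the components of `n` with
coefficients of degree at most `l`. -/
def SpansDegree (n : Fin 3 → MvPolynomial (Fin 2) K) (k l : ℕ) : Prop :=
  ∀ p ∈ degreeLT K (k + l + 1), ∃ q : Fin 3 → MvPolynomial (Fin 2) K,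
    (∀ i, q i ∈ degreeLT K (l + 1)) ∧ ∑ i, q i * n i = p

theorem mem_ideal_of_isHomogeneous {I : Ideal (MvPolynomial (Fin 2) K)} {s d : ℕ}
    (hI : ∀ j, X j ^ s ∈ I) (hd : 2 * s ≤ d) {p : MvPolynomial (Fin 2) K}
    (hp : p.IsHomogeneous d) : p ∈ I := by
  rw [← support_sum_monomial_coeff p]
  refine Ideal.sum_mem _ fun e he => ?_
  have hed : e 0 + e 1 = d := by
    rw [← sum_exponents_eq_of_isHomogeneous hp he, Fin.sum_univ_two]
  obtain ⟨j, hj⟩ : ∃ j, s ≤ e j := by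
    by_contra! h
    have h0 := h 0
    have h1 := h 1
    omega
  refine Ideal.mem_of_dvd _ ?_ (hI j)
  rw [X_pow_eq_monomial, monomial_dvd_monomial]
  refine ⟨Or.inr ?_, one_dvd _⟩
  rwa [Finsupp.single_le_iff]

/-- In degree at least 2s + k the top form of p lies in the ideal of the top forms of n, so
subtracting a combination of the n_i lowers the degree. What remains is multiplied by a fixed
representation of 1, at a bounded cost E in degree. -/
theorem exists_spansDegree {n : Fin 3 → MvPolynomial (Fin 2) K} {k s : ℕ}
    (hk : ∀ i, (n i).totalDegree ≤ k) (h1 : (1 : MvPolynomial (Fin 2) K) ∈ Ideal.span (Set.range n))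
    (hX : ∀ j, X j ^ s ∈ Ideal.span (Set.range fun i => homogeneousComponent k (n i))) :
    ∃ L, ∀ l, L ≤ l → SpansDegree n k l := by
  obtain ⟨e, he⟩ := Ideal.mem_span_range_iff_exists_fun.mp h1
  set E := Finset.univ.sup fun i => (e i).totalDegree with hE
  have heE : ∀ i, (e i).totalDegree ≤ E := fun i =>
    Finset.le_sup (f := fun i => (e i).totalDegree) (Finset.mem_univ i)
  refine ⟨2 * s + k + E, fun l hl => ?_⟩
  have key : ∀ d, d ≤ k + l + 1 → ∀ p ∈ degreeLT K d, ∃ q : Fin 3 → MvPolynomial (Fin 2) K,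
      (∀ i, q i ∈ degreeLT K (l + 1)) ∧ ∑ i, q i * n i = p := by
    intro d
    induction d with
    | zero =>
      intro _ p hp
      refine ⟨0, fun i => zero_mem _, ?_⟩
      rcases mem_degreeLT_iff.mp hp with rfl | h
      · simp
      · omega
    | succ d ih =>
      intro hd p hp
      rcases Nat.lt_or_ge d (2 * s + k) with hlt | hge
      · refine ⟨fun i => p * e i, fun i => ?_, ?_⟩
        · exact degreeLT_mono (by omega) (mul_mem_degreeLT hp (heE i))
        · simp only [mul_assoc, ← Finset.mul_sum, he, mul_one]
      · have htop := mem_ideal_of_isHomogeneous hX (d := d) (by omega)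
          (homogeneousComponent_isHomogeneous d p)
        obtain ⟨b, hb⟩ := Ideal.mem_span_range_iff_exists_fun.mp htop
        set a := fun i => homogeneousComponent (d - k) (b i) with ha
        have hab : ∑ i, a i * homogeneousComponent k (n i) = homogeneousComponent d p := by
          have := congrArg (homogeneousComponent d) hb
          rw [homogeneousComponent_of_mem (homogeneousComponent_isHomogeneous d p), if_pos rfl,
            map_sum] at this
          rw [← this]
          refine Finset.sum_congr rfl fun i _ => ?_
          rw [ha, ← homogeneousComponent_mul_of_isHomogeneous
            (homogeneousComponent_isHomogeneous k (n i)), Nat.sub_add_cancel (by omega)]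
        have hadeg : ∀ i, (a i).totalDegree ≤ d - k := fun i =>
          (homogeneousComponent_isHomogeneous _ _).totalDegree_le
        have hrem : p - ∑ i, a i * n i ∈ degreeLT K d := by
          have heq : p - ∑ i, a i * n i = (p - homogeneousComponent d p)
              - ∑ i, (n i - homogeneousComponent k (n i)) * a i := by
            rw [← hab]
            simp only [sub_mul, Finset.sum_sub_distrib, mul_comm (a _)]
            ring
          rw [heq]
          refine sub_mem (sub_homogeneousComponent_mem_degreeLT hp)
            (Submodule.sum_mem _ fun i _ => ?_)
          have := mul_mem_degreeLT
            (sub_homogeneousComponent_mem_degreeLT (mem_degreeLT_succ.mpr (hk i))) (hadeg i)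
          rwa [Nat.add_sub_cancel' (by omega : k ≤ d)] at this
        obtain ⟨q, hq, hqp⟩ := ih (by omega) _ hrem
        refine ⟨fun i => q i + a i, fun i => add_mem (hq i) ?_, ?_⟩
        · have := hadeg i
          rw [mem_degreeLT_succ]
          omega
        · simp only [add_mul, Finset.sum_add_distrib, hqp, sub_add_cancel]
  exact key _ le_rfl

theorem exists_spansDegree_of_basepointFree {n : Fin 3 → MvPolynomial (Fin 2) ℝ}
    (h : BasepointFree n) : ∃ L, ∀ l, L ≤ l → SpansDegree n (fieldDegree n) l := by
  obtain ⟨hfin, hinf⟩ := h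
  have hnull : ∀ (t : Fin 3 → MvPolynomial (Fin 2) ℝ) (p : MvPolynomial (Fin 2) ℝ),
      (∀ x : Fin 2 → ℂ, (∀ i, aeval x (t i) = 0) → aeval x p = 0) →
        ∃ s : ℕ, p ^ s ∈ Ideal.span (Set.range t) := by
    intro t p hp
    have : p ∈ (Ideal.span (Set.range t)).radical := by
      rw [← vanishingIdeal_zeroLocus_eq_radical (K := ℂ), zeroLocus_span]
      intro x hx
      exact hp x fun i => hx _ ⟨i, rfl⟩
    exact this
  have hk := totalDegree_le_fieldDegree n
  obtain ⟨s₁, hs₁⟩ := hnull n 1 fun x hx => (hfin ⟨x, hx⟩).elim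
  rw [one_pow] at hs₁
  have hj : ∀ j : Fin 2, ∃ s : ℕ,
      X j ^ s ∈ Ideal.span (Set.range fun i => homogeneousComponent (fieldDegree n) (n i)) := by
    intro j
    -- The top forms vanish together at most at the origin, where u and v vanish too.
    refine hnull _ _ fun x hx => ?_
    by_contra hne
    refine hinf ⟨x, ?_, hx⟩
    rintro rfl
    simp at hne
  choose s hs using hj
  refine exists_spansDegree (s := s 0 + s 1) hk hs₁ fun j => ?_
  refine Ideal.mem_of_dvd _ (pow_dvd_pow _ ?_) (hs j)
  fin_cases j <;> simp

theorem SpansDegree.basepointFree {n : Fin 3 → MvPolynomial (Fin 2) ℝ} {l : ℕ}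
    (h : SpansDegree n (fieldDegree n) l) : BasepointFree n := by
  have hk := totalDegree_le_fieldDegree n
  constructor
  · rintro ⟨x, hx⟩
    obtain ⟨q, -, hq⟩ := h 1 (by rw [mem_degreeLT_succ]; simp)
    have := congrArg (aeval x) hq
    simp [hx] at this
  · rintro ⟨x, hx0, hx⟩
    refine hx0 (funext fun j => ?_)
    -- In degree k + l only products of top forms survive. They vanish at x, forcing each coordinate
    -- of x to be 0.
    obtain ⟨q, hqd, hq⟩ := h (X j ^ (fieldDegree n + l)) (by
      rw [mem_degreeLT_succ, totalDegree_X_pow])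
    have hc := congrArg (homogeneousComponent (l + fieldDegree n)) hq
    rw [map_sum, add_comm l, homogeneousComponent_of_mem (isHomogeneous_X_pow j _), if_pos rfl,
      add_comm _ l] at hc
    have hc' := congrArg (aeval x) hc
    rw [map_sum, Finset.sum_eq_zero, map_pow, aeval_X] at hc'
    · by_contra hne
      exact pow_ne_zero _ hne hc'.symm
    · intro i _
      rw [homogeneousComponent_add_mul (mem_degreeLT_succ.mp (hqd i)) (hk i), map_mul, hx, mul_zero]

end Nullstellensatz

/-! ### Homogenization and the passage between affine and projective data. -/

section Homogenization

variable {K : Type*} [Field K]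

/-- The homogenization `w ^ k * p (u / w, v / w)` over an arbitrary field. -/
noncomputable def homogenize (k : ℕ) (p : MvPolynomial (Fin 2) K) : MvPolynomial (Fin 3) K :=
  ∑ m ∈ p.support, C (p.coeff m) * (X 0 ^ m 0 * X 1 ^ m 1 * X 2 ^ (k - (m 0 + m 1)))

theorem homogenizeTo_eq_homogenize (k : ℕ) (p : MvPolynomial (Fin 2) ℝ) :
    homogenizeTo k p = homogenize k (map (algebraMap ℝ ℂ) p) := by
  rw [homogenizeTo, homogenize, support_map_of_injective _ (algebraMap ℝ ℂ).injective]
  simp only [coeff_map]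
  rfl

theorem exponent_le_totalDegree {p : MvPolynomial (Fin 2) K} {m : Fin 2 →₀ ℕ} (hm : m ∈ p.support) :
    m 0 + m 1 ≤ p.totalDegree := by
  have := le_totalDegree hm
  rwa [Finsupp.sum_fintype _ _ (fun _ => rfl), Fin.sum_univ_two] at this

theorem homogenize_isHomogeneous {k : ℕ} {p : MvPolynomial (Fin 2) K} (hp : p.totalDegree ≤ k) :
    (homogenize k p).IsHomogeneous k := by
  refine IsHomogeneous.sum _ _ _ fun m hm => ?_
  have hmk := (exponent_le_totalDegree hm).trans hp
  have h := ((isHomogeneous_C (Fin 3) (p.coeff m)).mul (((isHomogeneous_X_pow (R := K) (0 : Fin 3)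
    (m 0)).mul (isHomogeneous_X_pow (1 : Fin 3) (m 1))).mul
      (isHomogeneous_X_pow (2 : Fin 3) (k - (m 0 + m 1)))))
  convert h using 1
  omega

/-- Substitution of `w = 1`. -/
noncomputable def dehomogenize (K : Type*) [Field K] :
    MvPolynomial (Fin 3) K →ₐ[K] MvPolynomial (Fin 2) K :=
  aeval ![X 0, X 1, 1]

theorem dehomogenize_homogenize (k : ℕ) (p : MvPolynomial (Fin 2) K) :
    dehomogenize K (homogenize k p) = p := by
  conv_rhs => rw [← support_sum_monomial_coeff p]
  rw [homogenize, map_sum]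
  refine Finset.sum_congr rfl fun m _ => ?_
  rw [monomial_eq, Finsupp.prod_fintype _ _ (fun _ => pow_zero _)]
  simp [dehomogenize, Fin.prod_univ_two]

theorem eval_dehomogenize (y : Fin 2 → K) (Q : MvPolynomial (Fin 3) K) :
    eval y (dehomogenize K Q) = eval ![y 0, y 1, 1] Q := by
  have h : (aeval y).comp (dehomogenize K) = aeval (R := K) ![y 0, y 1, 1] := by
    apply MvPolynomial.algHom_ext
    intro i
    fin_cases i <;> simp [dehomogenize]
  exact DFunLike.congr_fun h Q

theorem totalDegree_dehomogenize_le {d : ℕ} {Q : MvPolynomial (Fin 3) K} (hQ : Q.IsHomogeneous d) :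
    (dehomogenize K Q).totalDegree ≤ d := by
  rw [← mem_degreeLT_succ, dehomogenize, aeval_def, eval₂_eq']
  refine Submodule.sum_mem _ fun e he => ?_
  rw [mem_degreeLT_succ]
  have hed : e 0 + e 1 + e 2 = d := by
    rw [← sum_exponents_eq_of_isHomogeneous hQ he, Fin.sum_univ_three]
  refine (totalDegree_mul _ _).trans ?_
  rw [algebraMap_eq, totalDegree_C, zero_add, Fin.prod_univ_three]
  simp only [Matrix.cons_val, one_pow, mul_one]
  refine (totalDegree_mul _ _).trans ?_
  rw [totalDegree_X_pow, totalDegree_X_pow]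
  omega

theorem eval_smul_of_isHomogeneous {σ : Type*} [Fintype σ] {d : ℕ} {Q : MvPolynomial σ K}
    (hQ : Q.IsHomogeneous d) (c : K) (x : σ → K) : eval (c • x) Q = c ^ d * eval x Q := by
  rw [eval_eq', eval_eq', Finset.mul_sum]
  refine Finset.sum_congr rfl fun e he => ?_
  rw [← sum_exponents_eq_of_isHomogeneous hQ he, ← Finset.prod_pow_eq_pow_sum]
  simp only [Pi.smul_apply, smul_eq_mul, mul_pow, Finset.prod_mul_distrib]
  ring

theorem eval_of_last_ne_zero {d : ℕ} {Q : MvPolynomial (Fin 3) K} (hQ : Q.IsHomogeneous d)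
    {x : Fin 3 → K} (hx : x 2 ≠ 0) :
    eval x Q = x 2 ^ d * eval ![x 0 / x 2, x 1 / x 2] (dehomogenize K Q) := by
  rw [eval_dehomogenize, ← eval_smul_of_isHomogeneous hQ]
  congr 2
  ext i
  fin_cases i <;> simp [hx, mul_div_cancel₀]

theorem eq_zero_of_dehomogenize_eq_zero [Infinite K] {d : ℕ} {Q : MvPolynomial (Fin 3) K}
    (hQ : Q.IsHomogeneous d) (h : dehomogenize K Q = 0) : Q = 0 := by
  -- The dehomogenization determines Q where w ≠ 0; the factor w takes care of w = 0.
  have hX : Q * X 2 = 0 := by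
    apply MvPolynomial.funext
    intro x
    by_cases hx : x 2 = 0
    · simp [hx]
    · simp [eval_of_last_ne_zero hQ hx, h]
  exact (mul_eq_zero.mp hX).resolve_right (X_ne_zero _)

theorem eval_homogenize_of_last_eq_zero {k : ℕ} {p : MvPolynomial (Fin 2) K}
    (hp : p.totalDegree ≤ k) {x : Fin 3 → K} (hx : x 2 = 0) :
    eval x (homogenize k p) = eval ![x 0, x 1] (homogeneousComponent k p) := by
  rw [homogenize, homogeneousComponent_apply, map_sum, map_sum, Finset.sum_filter]
  refine Finset.sum_congr rfl fun m hm => ?_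
  have hmk := (exponent_le_totalDegree hm).trans hp
  rw [Finsupp.degree_eq_sum, Fin.sum_univ_two]
  split_ifs with h
  · simp [h, eval_monomial, Finsupp.prod_fintype, Fin.prod_univ_two]
  · have : k - (m 0 + m 1) ≠ 0 := by omega
    simp [hx, this]

end Homogenization

theorem totalDegree_map_le_fieldDegree (n : Fin 3 → MvPolynomial (Fin 2) ℝ) (i : Fin 3) :
    (map (algebraMap ℝ ℂ) (n i)).totalDegree ≤ fieldDegree n :=
  (Finset.sup_mono (support_map_subset _ _)).trans (totalDegree_le_fieldDegree n i)

theorem homBasepointFree_iff_basepointFree (n : Fin 3 → MvPolynomial (Fin 2) ℝ) :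
    HomBasepointFree (homogenizeField n) ↔ BasepointFree n := by
  have hdeg := totalDegree_map_le_fieldDegree n
  have hfin : ∀ (x : Fin 3 → ℂ) (i : Fin 3), x 2 ≠ 0 →
      (eval x (homogenizeField n i) = 0 ↔ aeval ![x 0 / x 2, x 1 / x 2] (n i) = 0) := by
    intro x i hx
    rw [homogenizeField, homogenizeTo_eq_homogenize,
      eval_of_last_ne_zero (homogenize_isHomogeneous (hdeg i)) hx, dehomogenize_homogenize,
      eval_map, ← aeval_def]
    simp [hx]
  have hinf : ∀ (x : Fin 3 → ℂ) (i : Fin 3), x 2 = 0 → eval x (homogenizeField n i)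
      = aeval ![x 0, x 1] (homogeneousComponent (fieldDegree n) (n i)) := by
    intro x i hx
    have hmap : homogeneousComponent (fieldDegree n) (map (algebraMap ℝ ℂ) (n i))
        = map (algebraMap ℝ ℂ) (homogeneousComponent (fieldDegree n) (n i)) := by
      ext m
      simp only [coeff_homogeneousComponent, coeff_map]
      split_ifs <;> simp
    rw [homogenizeField, homogenizeTo_eq_homogenize, eval_homogenize_of_last_eq_zero (hdeg i) hx,
      hmap, eval_map, ← aeval_def]
  constructor
  · intro h
    constructor
    · rintro ⟨y, hy⟩
      refine h ⟨![y 0, y 1, 1], fun h0 => by simpa using congrFun h0 2, fun i => ?_⟩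
      rw [hfin _ _ (by simp)]
      have : ![y 0, y 1] = y := by
        ext j
        fin_cases j <;> rfl
      simpa [this] using hy i
    · rintro ⟨y, hy0, hy⟩
      have hyy : ![y 0, y 1] = y := by
        ext j
        fin_cases j <;> rfl
      refine h ⟨![y 0, y 1, 0], fun h0 => hy0 ?_, fun i => ?_⟩
      · ext j
        fin_cases j
        · exact congrFun h0 0
        · exact congrFun h0 1
      · rw [hinf _ _ (by simp)]
        simpa [hyy] using hy i
  · rintro ⟨h1, h2⟩ ⟨x, hx0, hx⟩
    by_cases hx2 : x 2 = 0
    · refine h2 ⟨![x 0, x 1], fun h0 => hx0 ?_, fun i => ?_⟩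
      · ext j
        fin_cases j
        · exact congrFun h0 0
        · exact congrFun h0 1
        · exact hx2
      · rw [← hinf x i hx2]
        exact hx i
    · exact h1 ⟨_, fun i => (hfin x i hx2).mp (hx i)⟩

/-- A syzygy lifts by homogenizing to degree l: the sum of Q_i N_i is then a form of degree l + k
with zero dehomogenization, hence zero. -/
theorem map_dehomogenize_syzPiece (n : Fin 3 → MvPolynomial (Fin 2) ℝ) (l : ℕ) :
    Submodule.map ((dehomogenize ℂ).toLinearMap.compLeft (Fin 3))
        (syzPiece (homogenizeField n) l)
      = boundedSyz (fun i => map (algebraMap ℝ ℂ) (n i)) l := by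
  have hN : ∀ i, dehomogenize ℂ (homogenizeField n i) = map (algebraMap ℝ ℂ) (n i) := fun i => by
    rw [homogenizeField, homogenizeTo_eq_homogenize, dehomogenize_homogenize]
  have hNhom : ∀ i, (homogenizeField n i).IsHomogeneous (fieldDegree n) := fun i => by
    rw [homogenizeField, homogenizeTo_eq_homogenize]
    exact homogenize_isHomogeneous (totalDegree_map_le_fieldDegree n i)
  ext q
  rw [Submodule.mem_map, mem_boundedSyz]
  constructor
  · rintro ⟨Q, ⟨hQ, hQl⟩, rfl⟩
    have hQ' : ∑ i, Q i * homogenizeField n i = 0 := hQ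
    refine ⟨?_, fun i => ?_⟩
    · have := congrArg (dehomogenize ℂ) hQ'
      simpa [hN] using this
    · rw [mem_degreeLT_succ]
      exact totalDegree_dehomogenize_le (hQl i (Set.mem_univ i))
  · rintro ⟨h0, hq⟩
    have hhom : ∀ i, (homogenize l (q i)).IsHomogeneous l := fun i =>
      homogenize_isHomogeneous (mem_degreeLT_succ.mp (hq i))
    refine ⟨fun i => homogenize l (q i), ⟨?_, fun i _ => hhom i⟩, ?_⟩
    · change ∑ i, homogenize l (q i) * homogenizeField n i = 0
      refine eq_zero_of_dehomogenize_eq_zero (d := l + fieldDegree n)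
        (IsHomogeneous.sum _ _ _ fun i _ => (hhom i).mul (hNhom i)) ?_
      simpa [hN, dehomogenize_homogenize] using h0
    · ext1 i
      exact dehomogenize_homogenize l (q i)

theorem hilbertSyz_eq_finrank_boundedSyz (n : Fin 3 → MvPolynomial (Fin 2) ℝ) (l : ℕ) :
    hilbertSyz (homogenizeField n) l
      = Module.finrank ℂ (boundedSyz (fun i => map (algebraMap ℝ ℂ) (n i)) l) := by
  set f := ((dehomogenize ℂ).toLinearMap.compLeft (Fin 3)).domRestrict
    (syzPiece (homogenizeField n) l) with hf
  have hinj : Function.Injective f := by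
    rw [← LinearMap.ker_eq_bot, LinearMap.ker_eq_bot']
    rintro ⟨Q, hQ⟩ h
    ext1
    ext1 i
    exact eq_zero_of_dehomogenize_eq_zero (hQ.2 i (Set.mem_univ i)) (congrFun h i)
  rw [hilbertSyz, ← LinearMap.finrank_range_of_inj hinj, hf, LinearMap.range_domRestrict,
    map_dehomogenize_syzPiece]

/-! ### Comparison of real and complex dimensions. -/

/-- The kernel of a real matrix acting on complex vectors, split into real and imaginary parts. -/
noncomputable def kerMapOfRealEquiv {α β : Type*} [Fintype β] (M : Matrix α β ℝ) :
    LinearMap.ker (M.map (algebraMap ℝ ℂ)).mulVecLin ≃ₗ[ℝ]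
      LinearMap.ker M.mulVecLin × LinearMap.ker M.mulVecLin where
  toFun v := (⟨fun j => (v.1 j).re, by
      rw [LinearMap.mem_ker]
      ext i
      have h : (M.map (algebraMap ℝ ℂ)).mulVec v.1 i = 0 := congrFun v.2 i
      simpa [Matrix.mulVec, dotProduct] using congrArg Complex.re h⟩,
    ⟨fun j => (v.1 j).im, by
      rw [LinearMap.mem_ker]
      ext i
      have h : (M.map (algebraMap ℝ ℂ)).mulVec v.1 i = 0 := congrFun v.2 i
      simpa [Matrix.mulVec, dotProduct] using congrArg Complex.im h⟩)
  invFun v := ⟨fun j => ⟨v.1.1 j, v.2.1 j⟩, by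
    rw [LinearMap.mem_ker]
    ext i
    have h₁ : M.mulVec v.1.1 i = 0 := congrFun v.1.2 i
    have h₂ : M.mulVec v.2.1 i = 0 := congrFun v.2.2 i
    apply Complex.ext
    · simpa [Matrix.mulVec, dotProduct] using h₁
    · simpa [Matrix.mulVec, dotProduct] using h₂⟩
  left_inv v := rfl
  right_inv v := rfl
  map_add' v w := rfl
  map_smul' r v := by
    ext j <;> simp

theorem finrank_ker_map_ofReal {α β : Type*} [Fintype β] (M : Matrix α β ℝ) :
    Module.finrank ℂ (LinearMap.ker (M.map (algebraMap ℝ ℂ)).mulVecLin)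
      = Module.finrank ℝ (LinearMap.ker M.mulVecLin) := by
  have h := (kerMapOfRealEquiv M).finrank_eq
  rw [Module.finrank_prod, finrank_real_of_complex] at h
  omega

theorem finrank_orthogonalFields_eq_hilbertSyz (n : Fin 3 → MvPolynomial (Fin 2) ℝ) (l : ℕ) :
    Module.finrank ℝ (orthogonalFields n l) = hilbertSyz (homogenizeField n) l := by
  have hM : (sylvesterMatrix n (fieldDegree n + l) l).map (algebraMap ℝ ℂ)
      = sylvesterMatrix (fun i => map (algebraMap ℝ ℂ) (n i)) (fieldDegree n + l) l := by
    ext e c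
    simp only [sylvesterMatrix, Matrix.map_apply, Matrix.of_apply]
    rw [← coeff_map, map_mul, map_monomial, map_one]
  rw [hilbertSyz_eq_finrank_boundedSyz, finrank_boundedSyz l (totalDegree_map_le_fieldDegree n),
    show orthogonalFields n l = boundedSyz n l from rfl,
    finrank_boundedSyz l (totalDegree_le_fieldDegree n), ← finrank_ker_map_ofReal, hM]

/-! ### Dimension counts and conclusion. -/

theorem choose_two_sub_add_one (a b : ℕ) : Nat.choose (a - b + 1) 2 = Nat.choose (a + 1 - b) 2 := by
  rcases Nat.lt_or_ge a b with h | h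
  · rw [show a - b + 1 = 1 by omega, show a + 1 - b = 0 by omega]
    rfl
  · rw [Nat.sub_add_comm h]

/-- The third difference, with step k, of the quadratic x(x-1)/2 vanishes. The hypothesis keeps l +
2 - 2k from being truncated. -/
theorem choose_two_third_difference {k l : ℕ} (h : 2 * k ≤ l + 2) :
    3 * (Nat.choose (l + 2 - k) 2 : ℤ) - (Nat.choose (l + 2 - 2 * k) 2 : ℤ)
      = 3 * (Nat.choose (l + 2) 2 : ℤ) - (Nat.choose (k + l + 2) 2 : ℤ) := by
  obtain ⟨m, hm⟩ := Nat.exists_eq_add_of_le h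
  rw [show k + l + 2 = 3 * k + m by omega, hm, show 2 * k + m - k = k + m by omega,
    Nat.add_sub_cancel_left]
  have hq : 3 * (Nat.choose (k + m) 2 : ℚ) - (Nat.choose m 2 : ℚ)
      = 3 * (Nat.choose (2 * k + m) 2 : ℚ) - (Nat.choose (3 * k + m) 2 : ℚ) := by
    simp only [Nat.cast_choose_two]
    push_cast
    ring
  exact_mod_cast hq

/-- The zero polynomial has `totalDegree` 0, so for k = 0 a component attaining the maximum could be
zero; coprimality supplies a nonzero one. -/
theorem CoprimeComponents.exists_totalDegree_eq {n : Fin 3 → MvPolynomial (Fin 2) ℝ}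
    (hn : CoprimeComponents n) : ∃ i, n i ≠ 0 ∧ (n i).totalDegree = fieldDegree n := by
  rcases Nat.eq_zero_or_pos (fieldDegree n) with h0 | hpos
  · obtain ⟨i, hi⟩ : ∃ i, n i ≠ 0 := by
      by_contra! h
      exact not_isUnit_zero (hn 0 fun i => by rw [h i])
    have := totalDegree_le_fieldDegree n i
    exact ⟨i, hi, by omega⟩
  · obtain ⟨i, -, hi⟩ := Finset.exists_mem_eq_sup Finset.univ Finset.univ_nonempty
      fun i => (n i).totalDegree
    refine ⟨i, fun h => ?_, hi.symm⟩
    rw [fieldDegree, hi, h, totalDegree_zero] at hpos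
    exact lt_irrefl _ hpos

theorem fullRank_iff_spansDegree (n : Fin 3 → MvPolynomial (Fin 2) ℝ) (l : ℕ) :
    FullRank n l ↔ SpansDegree n (fieldDegree n) l :=
  rank_sylvesterMatrix_eq_card_iff l (totalDegree_le_fieldDegree n)

theorem fullRank_iff_finrank_orthogonalFields (n : Fin 3 → MvPolynomial (Fin 2) ℝ) (l : ℕ) :
    FullRank n l ↔ (Module.finrank ℝ (orthogonalFields n l) : ℤ)
      = 3 * (Nat.choose (l + 2) 2 : ℤ) - (Nat.choose (fieldDegree n + l + 2) 2 : ℤ) := by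
  have h := finrank_boundedSyz_add_rank l (totalDegree_le_fieldDegree n)
  have hr : FullRank n l ↔ (sylvesterMatrix n (fieldDegree n + l) l).rank
      = Nat.choose (fieldDegree n + l + 2) 2 := by
    rw [← card_exponents, ← Fintype.card_coe]
    rfl
  rw [hr, show orthogonalFields n l = boundedSyz n l from rfl]
  omega

instance (n : Fin 3 → MvPolynomial (Fin 2) ℝ) (l : ℕ) :
    FiniteDimensional ℝ (boundedSyz n l) := by
  rw [← map_ofCoeffs_ker l (totalDegree_le_fieldDegree n)]
  infer_instance

theorem finrank_koszul_eq {n : Fin 3 → MvPolynomial (Fin 2) ℝ} (hn : CoprimeComponents n) (l : ℕ) :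
    (Module.finrank ℝ (LinearMap.range (koszulMap n (l + 1 - fieldDegree n))) : ℤ)
      = 3 * (Nat.choose (l + 2 - fieldDegree n) 2 : ℤ)
        - (Nat.choose (l + 2 - 2 * fieldDegree n) 2 : ℤ) := by
  have h := finrank_range_koszulMap (totalDegree_le_fieldDegree n) hn.exists_totalDegree_eq hn
    (l + 1 - fieldDegree n)
  rw [Nat.sub_sub, ← two_mul, choose_two_sub_add_one, choose_two_sub_add_one,
    show l + 1 + 1 = l + 2 from rfl] at h
  omega

theorem koszul_le_finrank_orthogonalFields {n : Fin 3 → MvPolynomial (Fin 2) ℝ}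
    (hn : CoprimeComponents n) (l : ℕ) :
    3 * (Nat.choose (l + 2 - fieldDegree n) 2 : ℤ)
        - (Nat.choose (l + 2 - 2 * fieldDegree n) 2 : ℤ)
      ≤ (Module.finrank ℝ (orthogonalFields n l) : ℤ) := by
  rw [← finrank_koszul_eq hn]
  exact_mod_cast Submodule.finrank_mono (t := boundedSyz n l)
    (range_koszulMap_le (totalDegree_le_fieldDegree n) l)

/-- Without base points all syzygies are Koszul syzygies. -/
theorem boundedSyz_eq_range_koszulMap {n : Fin 3 → MvPolynomial (Fin 2) ℝ}
    (hn : CoprimeComponents n) (h : BasepointFree n) (l : ℕ) :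
    boundedSyz n l = LinearMap.range (koszulMap n (l + 1 - fieldDegree n)) := by
  have hk := totalDegree_le_fieldDegree n
  refine le_antisymm ?_ (range_koszulMap_le hk l)
  obtain ⟨L, hL⟩ := exists_spansDegree_of_basepointFree h
  -- This threshold gives full rank and also lies in the range of the third-difference identity, so
  -- the Koszul subspace has full dimension.
  have hlarge : ∀ l, L + 2 * fieldDegree n ≤ l →
      boundedSyz n l ≤ LinearMap.range (koszulMap n (l + 1 - fieldDegree n)) := by
    intro l hl
    have hfull := (fullRank_iff_finrank_orthogonalFields n l).mp
      ((fullRank_iff_spansDegree n l).mpr (hL l (by omega)))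
    rw [← choose_two_third_difference (by omega), ← finrank_koszul_eq hn] at hfull
    exact (Submodule.eq_of_le_of_finrank_eq (range_koszulMap_le hk l)
      (by exact_mod_cast hfull.symm)).ge
  have hdesc : ∀ j l, L + 2 * fieldDegree n ≤ l + j →
      boundedSyz n l ≤ LinearMap.range (koszulMap n (l + 1 - fieldDegree n)) := by
    intro j
    induction j with
    | zero => exact hlarge
    | succ j ih =>
      intro l hl
      exact boundedSyz_le_range_koszulMap_of_succ hk hn.exists_totalDegree_eq hn
        (ih (l + 1) (by omega))
  exact hdesc (L + 2 * fieldDegree n) l (by omega)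

theorem mainTheorem5 (n : Fin 3 → MvPolynomial (Fin 2) ℝ) (k : ℕ) (hk : fieldDegree n = k)
    (hn : CoprimeComponents n) :
    -- the lower bound for the Hilbert function; `Nat.choose (l + 2 - a) 2` is the dimension of the
    -- forms of degree `l - a` in three variables, and is `0` for `l < a`
    (∀ l : ℕ, 3 * (Nat.choose (l + 2 - k) 2 : ℤ) - (Nat.choose (l + 2 - 2 * k) 2 : ℤ)
      ≤ (hilbertSyz (homogenizeField n) l : ℤ)) ∧
    -- equality in all degrees
    ((∀ l : ℕ, (hilbertSyz (homogenizeField n) l : ℤ)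
        = 3 * (Nat.choose (l + 2 - k) 2 : ℤ) - (Nat.choose (l + 2 - 2 * k) 2 : ℤ))
      ↔ HomBasepointFree (homogenizeField n)) ∧
    -- equality in one degree `l ≥ 2 k - 2`
    (∀ l : ℕ, 2 * k ≤ l + 2 →
      ((hilbertSyz (homogenizeField n) l : ℤ)
          = 3 * (Nat.choose (l + 2 - k) 2 : ℤ) - (Nat.choose (l + 2 - 2 * k) 2 : ℤ)
        ↔ HomBasepointFree (homogenizeField n))) ∧
    -- the affine reformulation
    (HomBasepointFree (homogenizeField n) ↔ BasepointFree n) ∧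
    (∀ l : ℕ, Module.finrank ℝ (orthogonalFields n l) = hilbertSyz (homogenizeField n) l) ∧
    (∀ l : ℕ, FullRank n l → BasepointFree n) ∧
    (∀ l : ℕ, 2 * k ≤ l + 2 → (FullRank n l ↔ BasepointFree n)) ∧
    (BasepointFree n → ∀ l : ℕ, 2 * k ≤ l + 2 →
      (Module.finrank ℝ (orthogonalFields n l) : ℤ)
        = 3 * (Nat.choose (l + 2) 2 : ℤ) - (Nat.choose (k + l + 2) 2 : ℤ)) := by
  subst hk
  have hfull : ∀ l, FullRank n l → BasepointFree n := fun l h =>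
    ((fullRank_iff_spansDegree n l).mp h).basepointFree
  have heq : BasepointFree n → ∀ l, (Module.finrank ℝ (orthogonalFields n l) : ℤ)
      = 3 * (Nat.choose (l + 2 - fieldDegree n) 2 : ℤ)
        - (Nat.choose (l + 2 - 2 * fieldDegree n) 2 : ℤ) := by
    intro h l
    rw [← finrank_koszul_eq hn, ← boundedSyz_eq_range_koszulMap hn h]
    rfl
  have hiff : ∀ l, 2 * fieldDegree n ≤ l + 2 →
      ((Module.finrank ℝ (orthogonalFields n l) : ℤ)
        = 3 * (Nat.choose (l + 2 - fieldDegree n) 2 : ℤ)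
          - (Nat.choose (l + 2 - 2 * fieldDegree n) 2 : ℤ) ↔ FullRank n l) := by
    intro l hl
    rw [choose_two_third_difference hl, fullRank_iff_finrank_orthogonalFields]
  simp only [← finrank_orthogonalFields_eq_hilbertSyz, homBasepointFree_iff_basepointFree]
  refine ⟨koszul_le_finrank_orthogonalFields hn, ⟨fun h => ?_, heq⟩, fun l hl => ⟨fun h => ?_,
    fun h => heq h l⟩, trivial, fun _ => trivial, hfull, fun l hl => ⟨hfull l, fun h => ?_⟩,
    fun h l hl => ?_⟩
  -- Any single degree l ≥ 2k - 2 would do; l = 2k is one.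
  · exact hfull _ ((hiff (2 * fieldDegree n) (by omega)).mp (h _))
  · exact hfull l ((hiff l hl).mp h)
  · exact (hiff l hl).mp (heq h l)
  · rw [← choose_two_third_difference hl]
    exact heq h l
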